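/- Let $n\ge 1$ and let $G$ be a simple undirected graph on the vertices $1,\dots,n$ in which every edge $ij$ carries a weight $w_{ij}>0$. Let $W(G)$ be its weight matrix (with entry $w_{ij}$ if $ij$ is an edge and $0$ otherwise), let $d=(d_1,\dots,d_n)^\top$ be the sequence of its vertex degrees (the numbers of neighbours, regardless of the weights), and let $L=\operatorname{diag}(W(G)\mathbf 1)-W(G)$ be its weighted Laplacian matrix, where $\mathbf 1$ is the all-ones column vector. Let $G^{-1}$ be the same graph with every weight $w_{ij}$ replaced by $1/w_{ij}$. Let $D$ be a real symmetric $n\times n$ matrix with zero diagonal such that $D\ge W(G^{-1})$ entrywise. Suppose that all the entries of $$LD+2I-(2\cdot\mathbf 1-d)\mathbf 1^\top$$ strictly above the main diagonal are zero. Then $G$ is a tree, and $D$ is the distance matrix of $G^{-1}$, i.e. for all $i,j$ the entry $D_{ij}$ is the minimum, over the paths from $i$ to $j$, of the sum of the weights $1/w_{kl}$ of the edges $kl$ of the path. Consequently the remaining (diagonal and lower-triangular) equations hold as well: $LD+2I=(2\cdot\mathbf 1-d)\mathbf 1^\top$. -/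

import Mathlib

open scoped Matrix

/-- A simple undirected graph with a positive real weight on every edge. -/
structure WeightedGraph (V : Type*) where
  graph : SimpleGraph V
  weight : graph.edgeSet → ℝ
  weight_pos : ∀ e, 0 < weight e

namespace WeightedGraph

variable {V : Type*}

/-- The graph with the same edges and with all the weights replaced by their reciprocals. -/
noncomputable instance : Inv (WeightedGraph V) where
  inv G :=
    { graph := G.graph
      weight := fun e => (G.weight e)⁻¹
      weight_pos := fun e => inv_pos.mpr (G.weight_pos e) }

open Classical in
/-- The weight matrix `W(G)`: the weight of `ij` if `ij` is an edge, and `0` otherwise. -/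
noncomputable def weightMatrix (G : WeightedGraph V) : Matrix V V ℝ :=
  Matrix.of fun i j =>
    if h : G.graph.Adj i j then G.weight ⟨s(i, j), (SimpleGraph.mem_edgeSet G.graph).mpr h⟩ else 0

open Classical in
/-- The degree sequence `d(G) = X(G) 1`, where `X(G)` is the 0-1 adjacency matrix
(weights play no role). -/
noncomputable def degreeVec [Fintype V] (G : WeightedGraph V) : V → ℝ :=
  G.graph.adjMatrix ℝ *ᵥ 1

/-- The Laplacian matrix `L(G) = diag (W(G) 1) - W(G)`. -/
noncomputable def laplacian [Fintype V] [DecidableEq V] (G : WeightedGraph V) : Matrix V V ℝ :=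
  Matrix.diagonal (G.weightMatrix *ᵥ 1) - G.weightMatrix

/-- The weight of a walk: the sum of the weights of the edges that it traverses. -/
noncomputable def walkWeight (G : WeightedGraph V) {i j : V} (p : G.graph.Walk i j) : ℝ :=
  (p.darts.map fun e => G.weightMatrix e.fst e.snd).sum

/-- `D` is the distance matrix of `G`: every entry `D i j` is the (attained) minimum of the weights
of the paths from `i` to `j`. In particular all the paths asked for exist, and `D i i = 0`,
the only path from `i` to `i` being the trivial one. -/
def IsDistanceMatrix (G : WeightedGraph V) (D : Matrix V V ℝ) : Prop :=
  ∀ i j, IsLeast {x : ℝ | ∃ p : G.graph.Walk i j, p.IsPath ∧ G.walkWeight p = x} (D i j)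

end WeightedGraph

/-- The strictly upper triangular part of a square matrix. -/
def strictUpper {n : ℕ} (A : Matrix (Fin n) (Fin n) ℝ) : Matrix (Fin n) (Fin n) ℝ :=
  Matrix.of fun i j => if i < j then A i j else 0

namespace WeightedGraph

variable {V : Type*}

/-! Read column `j` of the equations as a flow driven by the potential `D · j`: each `i < j` emits
`2 - d i`, and net flow over a union of components vanishes. For such a union `S` with largest
vertex `m`, `D ≥ W(G⁻¹)` bounds the flow out of `m` by `-d m`, so column `m` gives degree sum at
most `2 * #S - 2`. If `S` missed the last vertex `t`, column `t` would give exactly `2 * #S`. So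
every component contains `t`, and a connected graph with so few edges is a tree
(`isTree_of_strictUpper`). The tree's distance matrix satisfies the same equations
(`laplacian_mul_of_isDistanceMatrix`), whose solution is unique (`eq_of_laplacian_mul_apply_eq`). -/

theorem weightMatrix_of_adj (G : WeightedGraph V) {i j : V} (h : G.graph.Adj i j) :
    0 < G.weightMatrix i j := by
  simp [weightMatrix, h, G.weight_pos]

theorem weightMatrix_of_not_adj (G : WeightedGraph V) {i j : V} (h : ¬G.graph.Adj i j) :
    G.weightMatrix i j = 0 := by
  simp [weightMatrix, h]

theorem weightMatrix_nonneg (G : WeightedGraph V) (i j : V) : 0 ≤ G.weightMatrix i j := by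
  by_cases h : G.graph.Adj i j
  · exact (G.weightMatrix_of_adj h).le
  · exact (G.weightMatrix_of_not_adj h).ge

theorem weightMatrix_comm (G : WeightedGraph V) (i j : V) :
    G.weightMatrix i j = G.weightMatrix j i := by
  by_cases h : G.graph.Adj i j
  · simp [weightMatrix, h, h.symm, Sym2.eq_swap]
  · rw [G.weightMatrix_of_not_adj h, G.weightMatrix_of_not_adj fun h' => h h'.symm]

@[simp]
theorem inv_graph (G : WeightedGraph V) : G⁻¹.graph = G.graph := rfl

theorem inv_weightMatrix (G : WeightedGraph V) (i j : V) :
    G⁻¹.weightMatrix i j = (G.weightMatrix i j)⁻¹ := by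
  by_cases h : G.graph.Adj i j
  · have h' : G⁻¹.graph.Adj i j := h
    simp only [weightMatrix, Matrix.of_apply, dif_pos h, dif_pos h']
    rfl
  · rw [G.weightMatrix_of_not_adj h, inv_zero]
    exact G⁻¹.weightMatrix_of_not_adj h

/-! ### Path weights and distances in forests -/

section Walk

theorem walkWeight_cons (G : WeightedGraph V) {i j k : V} (h : G.graph.Adj i j)
    (p : G.graph.Walk j k) :
    G.walkWeight (p.cons h) = G.weightMatrix i j + G.walkWeight p := by
  simp [walkWeight]

theorem walkWeight_reverse (G : WeightedGraph V) {i j : V} (p : G.graph.Walk i j) :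
    G.walkWeight p.reverse = G.walkWeight p := by
  simp only [walkWeight, SimpleGraph.Walk.darts_reverse, List.map_reverse, List.sum_reverse,
    List.map_map]
  congr 1
  exact List.map_congr_left fun e _ => G.weightMatrix_comm _ _

theorem IsDistanceMatrix.walkWeight_eq {G : WeightedGraph V} {E : Matrix V V ℝ}
    (hE : G.IsDistanceMatrix E) (hG : G.graph.IsAcyclic) {i j : V} {p : G.graph.Walk i j}
    (hp : p.IsPath) : G.walkWeight p = E i j := by
  obtain ⟨q, hq, h⟩ := (hE i j).1
  rw [← h, show p = q from congrArg Subtype.val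
    ((hG.subsingleton_path i j).elim ⟨p, hp⟩ ⟨q, hq⟩)]

theorem IsDistanceMatrix.apply_self {G : WeightedGraph V} {E : Matrix V V ℝ}
    (hE : G.IsDistanceMatrix E) (i : V) : E i i = 0 := by
  obtain ⟨q, hq, h⟩ := (hE i i).1
  rw [← h, (SimpleGraph.Walk.isPath_iff_nil.1 hq).eq_nil]
  simp [walkWeight]

theorem IsDistanceMatrix.isSymm {G : WeightedGraph V} {E : Matrix V V ℝ}
    (hE : G.IsDistanceMatrix E) (hG : G.graph.IsAcyclic) : E.IsSymm := by
  refine Matrix.IsSymm.ext fun i j => ?_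
  obtain ⟨p, hp, h⟩ := (hE i j).1
  rw [← h, ← walkWeight_reverse, hE.walkWeight_eq hG hp.reverse]

theorem exists_isDistanceMatrix_of_isTree (G : WeightedGraph V) (hG : G.graph.IsTree) :
    ∃ E, G.IsDistanceMatrix E := by
  choose p hp hu using hG.existsUnique_path
  refine ⟨Matrix.of fun i j => G.walkWeight (p i j), fun i j => ⟨⟨p i j, hp i j, rfl⟩, ?_⟩⟩
  rintro _ ⟨q, hq, rfl⟩
  rw [hu i j q hq, Matrix.of_apply]

/-- In a forest, exactly one neighbour of `i` is closer to `j ≠ i`. -/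
theorem IsDistanceMatrix.exists_neighbor {G : WeightedGraph V} {E : Matrix V V ℝ}
    (hE : G.IsDistanceMatrix E) (hG : G.graph.IsAcyclic) {i j : V} (hij : i ≠ j) :
    ∃ k, G.graph.Adj i k ∧ E i j = G.weightMatrix i k + E k j ∧
      ∀ l, G.graph.Adj i l → l ≠ k → E l j = G.weightMatrix i l + E i j := by
  obtain ⟨p, hp, -⟩ := (hE i j).1
  cases p with
  | nil => exact absurd rfl hij
  | @cons _ k _ h q =>
    refine ⟨k, h, ?_, fun l hl hlk => ?_⟩
    · rw [← hE.walkWeight_eq hG hp, walkWeight_cons, hE.walkWeight_eq hG hp.of_cons]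
    · have hmem : l ∉ (q.cons h).support := fun hmem =>
        hlk (by simpa using hG.eq_snd_of_adj_start hp hl hmem)
      have hp' : ((q.cons h).cons hl.symm).IsPath := hp.cons hmem
      rw [← hE.walkWeight_eq hG hp', walkWeight_cons, hE.walkWeight_eq hG hp, weightMatrix_comm]

end Walk

/-! ### Flows, energy and degree sums -/

section Laplacian

variable [Fintype V]

open Classical in
theorem degreeVec_apply (G : WeightedGraph V) (i : V) :
    G.degreeVec i = G.graph.degree i := by
  exact (G.graph.adjMatrix_mulVec_const_apply (a := 1)).trans (mul_one _)

theorem degreeVec_eq_sum (G : WeightedGraph V) (i : V) :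
    G.degreeVec i = ∑ k, G.weightMatrix i k * G⁻¹.weightMatrix i k := by
  classical
  simp only [degreeVec, Matrix.mulVec, dotProduct, Pi.one_apply, mul_one,
    SimpleGraph.adjMatrix_apply, inv_weightMatrix]
  refine Finset.sum_congr rfl fun k _ => ?_
  split_ifs with h
  · rw [mul_inv_cancel₀ (G.weightMatrix_of_adj h).ne']
  · rw [G.weightMatrix_of_not_adj h, zero_mul]

theorem laplacian_mul_apply [DecidableEq V] (G : WeightedGraph V) (D : Matrix V V ℝ) (i j : V) :
    (G.laplacian * D) i j = ∑ k, G.weightMatrix i k * (D i j - D k j) := by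
  rw [laplacian, Matrix.sub_mul, Matrix.sub_apply, Matrix.diagonal_mul, Matrix.mul_apply]
  simp only [Matrix.mulVec, dotProduct, Pi.one_apply, mul_one, mul_sub, Finset.sum_sub_distrib,
    Finset.sum_mul]

/-- A set of vertices closed under adjacency carries no net flow. -/
theorem sum_flow_eq_zero (G : WeightedGraph V) (f : V → ℝ) (S : Finset V)
    (hS : ∀ i ∈ S, ∀ k, G.graph.Adj i k → k ∈ S) :
    ∑ i ∈ S, ∑ k, G.weightMatrix i k * (f i - f k) = 0 := by
  have h : ∑ i ∈ S, ∑ k, G.weightMatrix i k * (f i - f k)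
      = ∑ i ∈ S, ∑ k ∈ S, G.weightMatrix i k * (f i - f k) := by
    refine Finset.sum_congr rfl fun i hi => (Finset.sum_subset S.subset_univ fun k _ hk => ?_).symm
    rw [G.weightMatrix_of_not_adj fun hik => hk (hS i hi k hik), zero_mul]
  have h' : ∑ i ∈ S, ∑ k ∈ S, G.weightMatrix i k * (f i - f k)
      = -∑ i ∈ S, ∑ k ∈ S, G.weightMatrix i k * (f i - f k) := by
    conv_lhs => rw [Finset.sum_comm]
    simp only [← Finset.sum_neg_distrib]
    refine Finset.sum_congr rfl fun i _ => Finset.sum_congr rfl fun k _ => ?_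
    rw [G.weightMatrix_comm k i]
    ring
  linarith

/-- The Dirichlet energy of a function vanishes only if the function is locally constant. -/
theorem eq_of_adj_of_energy_eq_zero (G : WeightedGraph V) (f : V → ℝ)
    (hf : ∑ i, f i * ∑ k, G.weightMatrix i k * (f i - f k) = 0) {i k : V}
    (h : G.graph.Adj i k) : f i = f k := by
  have hswap : ∑ i, f i * ∑ k, G.weightMatrix i k * (f i - f k)
      = ∑ i, ∑ k, G.weightMatrix i k * (f k * (f k - f i)) := by
    rw [Finset.sum_comm]
    refine Finset.sum_congr rfl fun i _ => ?_
    rw [Finset.mul_sum]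
    refine Finset.sum_congr rfl fun k _ => ?_
    rw [G.weightMatrix_comm k i]
    ring
  have hsq : ∑ i, ∑ k, G.weightMatrix i k * (f i - f k) ^ 2 = 0 := by
    calc _ = ∑ i, f i * ∑ k, G.weightMatrix i k * (f i - f k)
          + ∑ i, ∑ k, G.weightMatrix i k * (f k * (f k - f i)) := by
          simp only [Finset.mul_sum, ← Finset.sum_add_distrib]
          refine Finset.sum_congr rfl fun i _ => Finset.sum_congr rfl fun k _ => by ring
      _ = 0 := by rw [← hswap, hf, add_zero]
  have hnn : ∀ i k, 0 ≤ G.weightMatrix i k * (f i - f k) ^ 2 := fun i k =>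
    mul_nonneg (G.weightMatrix_nonneg i k) (sq_nonneg _)
  have h1 := (Finset.sum_eq_zero_iff_of_nonneg fun i _ => Finset.sum_nonneg fun k _ => hnn i k).1
    hsq i (Finset.mem_univ i)
  have h2 := (Finset.sum_eq_zero_iff_of_nonneg fun k _ => hnn i k).1 h1 k (Finset.mem_univ k)
  rcases mul_eq_zero.1 h2 with h0 | h0
  · exact absurd h0 (G.weightMatrix_of_adj h).ne'
  · exact sub_eq_zero.1 (pow_eq_zero_iff two_ne_zero |>.1 h0)

/-- Every term of the Dirichlet energy vanishes, so `f` is constant along a walk to the zero `j`. -/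
theorem eq_zero_of_harmonic (G : WeightedGraph V) (hG : G.graph.Connected) (f : V → ℝ)
    (hf : ∀ i, f i = 0 ∨ ∑ k, G.weightMatrix i k * (f i - f k) = 0) {j : V} (hj : f j = 0)
    (i : V) : f i = 0 := by
  have henergy : ∑ i, f i * ∑ k, G.weightMatrix i k * (f i - f k) = 0 :=
    Finset.sum_eq_zero fun i _ => by rcases hf i with h | h <;> rw [h] <;> simp
  obtain ⟨p⟩ := hG.preconnected i j
  induction p with
  | nil => exact hj
  | cons h _ ih => rw [G.eq_of_adj_of_energy_eq_zero f henergy h, ih hj]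

/-- The Graham–Lovász identity for the distance matrix of a weighted tree. -/
theorem laplacian_mul_of_isDistanceMatrix [DecidableEq V] (G : WeightedGraph V)
    (hG : G.graph.IsAcyclic) {E : Matrix V V ℝ} (hE : G⁻¹.IsDistanceMatrix E) :
    G.laplacian * E + (2 : ℝ) • (1 : Matrix V V ℝ)
      = Matrix.vecMulVec ((2 : ℝ) • (1 : V → ℝ) - G.degreeVec) (1 : V → ℝ) := by
  ext i j
  simp only [Matrix.add_apply, laplacian_mul_apply, Matrix.smul_apply, Matrix.vecMulVec_apply,
    Pi.sub_apply, Pi.smul_apply, Pi.one_apply, smul_eq_mul, mul_one, degreeVec_eq_sum]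
  rw [eq_sub_iff_add_eq, add_right_comm, ← Finset.sum_add_distrib]
  simp only [← mul_add]
  rcases eq_or_ne i j with rfl | hij
  · rw [Matrix.one_apply_eq, mul_one, add_eq_right]
    refine Finset.sum_eq_zero fun k _ => ?_
    by_cases h : G.graph.Adj i k
    · have hp : (SimpleGraph.Walk.nil.cons (show G⁻¹.graph.Adj k i from h.symm)).IsPath := by
        simpa using h.ne'
      rw [← hE.walkWeight_eq hG hp, walkWeight_cons, hE.apply_self, G⁻¹.weightMatrix_comm k i]
      simp [walkWeight]
    · rw [G.weightMatrix_of_not_adj h, zero_mul]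
  · rw [Matrix.one_apply_ne hij, mul_zero, add_zero]
    obtain ⟨k, hk, hki, hl⟩ := hE.exists_neighbor hG hij
    -- The neighbour towards `j` contributes `1 + 1`; every other neighbour contributes `-1 + 1`.
    rw [Finset.sum_eq_single k]
    · rw [hki, inv_weightMatrix]
      field_simp [(G.weightMatrix_of_adj hk).ne']
      ring
    · intro l _ hlk
      by_cases h : G.graph.Adj i l
      · rw [hl l h hlk]
        ring
      · rw [G.weightMatrix_of_not_adj h, zero_mul]
    · simp

/-- A vertex set closed under adjacency, all of whose vertices except `m` satisfy the
Graham–Lovász equations for `f`, has degree sum at most `2 * (#S - 1)`. -/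
theorem sum_degreeVec_add_two_le (G : WeightedGraph V) (f : V → ℝ) (S : Finset V)
    (hS : ∀ i ∈ S, ∀ k, G.graph.Adj i k → k ∈ S) {m : V} (hm : m ∈ S) (hfm : f m = 0)
    (hf : ∀ k, G⁻¹.weightMatrix m k ≤ f k)
    (heq : ∀ i ∈ S, i ≠ m → ∑ k, G.weightMatrix i k * (f i - f k) = 2 - G.degreeVec i) :
    ∑ i ∈ S, G.degreeVec i + 2 ≤ 2 * (S.card : ℝ) := by
  classical
  have hflow := G.sum_flow_eq_zero f S hS
  rw [← Finset.add_sum_erase S _ hm, Finset.sum_congr rfl fun i hi =>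
    heq i (Finset.mem_of_mem_erase hi) (Finset.ne_of_mem_erase hi), Finset.sum_sub_distrib] at hflow
  have hdeg : ∑ k, G.weightMatrix m k * (f m - f k) ≤ -G.degreeVec m := by
    rw [G.degreeVec_eq_sum, ← Finset.sum_neg_distrib]
    refine Finset.sum_le_sum fun k _ => ?_
    have := mul_le_mul_of_nonneg_left (hf k) (G.weightMatrix_nonneg m k)
    rw [hfm]
    linarith
  rw [← Finset.add_sum_erase S _ hm, ← Finset.card_erase_add_one hm]
  simp only [Finset.sum_const, nsmul_eq_mul] at hflow
  push_cast
  linarith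

theorem isTree_of_sum_degreeVec_le (G : WeightedGraph V) (hG : G.graph.Connected)
    (h : ∑ i, G.degreeVec i + 2 ≤ 2 * (Fintype.card V : ℝ)) : G.graph.IsTree := by
  classical
  refine SimpleGraph.isTree_iff_connected_and_card.2 ⟨hG, le_antisymm ?_ ?_⟩
  · simp only [degreeVec_apply] at h
    have h' : ∑ i, G.graph.degree i + 2 ≤ 2 * Fintype.card V := by exact_mod_cast h
    rw [SimpleGraph.sum_degrees_eq_twice_card_edges, SimpleGraph.edgeFinset_card] at h'
    rw [Nat.card_eq_fintype_card, Nat.card_eq_fintype_card]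
    omega
  · exact hG.card_vert_le_card_edgeSet_add_one

end Laplacian

/-! ### Consequences of the strictly upper triangular equations -/

section StrictUpper

variable {n : ℕ}

theorem laplacian_mul_apply_of_strictUpper (G : WeightedGraph (Fin n))
    {D : Matrix (Fin n) (Fin n) ℝ}
    (hupper : strictUpper (G.laplacian * D + (2 : ℝ) • (1 : Matrix (Fin n) (Fin n) ℝ)
      - Matrix.vecMulVec ((2 : ℝ) • (1 : Fin n → ℝ) - G.degreeVec) (1 : Fin n → ℝ)) = 0)
    {i j : Fin n} (hij : i < j) :
    ∑ k, G.weightMatrix i k * (D i j - D k j) = 2 - G.degreeVec i := by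
  have h := congrFun₂ hupper i j
  simp only [strictUpper, Matrix.of_apply, if_pos hij, Matrix.sub_apply, Matrix.add_apply,
    laplacian_mul_apply, Matrix.smul_apply, Matrix.one_apply_ne hij.ne, Matrix.vecMulVec_apply,
    Pi.sub_apply, Pi.smul_apply, Pi.one_apply, smul_eq_mul, mul_zero, add_zero, mul_one,
    Matrix.zero_apply] at h
  linarith

theorem isTree_of_strictUpper (hn : 1 ≤ n) (G : WeightedGraph (Fin n))
    (D : Matrix (Fin n) (Fin n) ℝ) (hsymm : D.IsSymm) (hdiag : ∀ i, D i i = 0)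
    (hD : ∀ i j, G⁻¹.weightMatrix i j ≤ D i j)
    (heq : ∀ i j, i < j → ∑ k, G.weightMatrix i k * (D i j - D k j) = 2 - G.degreeVec i) :
    G.graph.IsTree := by
  classical
  obtain ⟨t, ht⟩ : ∃ t : Fin n, ∀ i, i ≤ t :=
    ⟨⟨n - 1, by omega⟩, fun i => Fin.le_def.2 (by have := i.2; simp; omega)⟩
  have hsum : ∀ S : Finset (Fin n), (∀ i ∈ S, ∀ k, G.graph.Adj i k → k ∈ S) → S.Nonempty →
      ∑ i ∈ S, G.degreeVec i + 2 ≤ 2 * (S.card : ℝ) := by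
    intro S hS hne
    -- Taking the maximum of `S` puts every other vertex of `S` above the diagonal in its column.
    refine G.sum_degreeVec_add_two_le (fun i => D i (S.max' hne)) S hS (S.max'_mem hne)
      (hdiag _) (fun k => ?_) fun i hi him => heq _ _ (lt_of_le_of_ne (S.le_max' i hi) him)
    exact (hD _ _).trans (hsymm.apply _ _).ge
  have hmem : ∀ S : Finset (Fin n), (∀ i ∈ S, ∀ k, G.graph.Adj i k → k ∈ S) → S.Nonempty →
      t ∈ S := by
    intro S hS hne
    by_contra htS
    have hflow := G.sum_flow_eq_zero (fun i => D i t) S hS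
    rw [Finset.sum_congr rfl fun i hi =>
      heq i t (lt_of_le_of_ne (ht i) fun h => htS (h ▸ hi)), Finset.sum_sub_distrib] at hflow
    have := hsum S hS hne
    simp only [Finset.sum_const, nsmul_eq_mul] at hflow
    linarith
  have hreach : ∀ i, G.graph.Reachable i t := fun i => by
    simpa using hmem {k | G.graph.Reachable i k}
      (fun j hj k hjk => by simpa using (Finset.mem_filter.1 hj).2.trans hjk.reachable)
      ⟨i, by simp⟩
  have hconn : G.graph.Connected :=
    { preconnected := fun i j => (hreach i).trans (hreach j).symm
      nonempty := ⟨t⟩ }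
  refine G.isTree_of_sum_degreeVec_le hconn ?_
  simpa using hsum Finset.univ (fun _ _ k _ => Finset.mem_univ k) ⟨t, Finset.mem_univ t⟩

/-- The strictly upper triangular equations determine the symmetric matrix `D`. -/
theorem eq_of_laplacian_mul_apply_eq (G : WeightedGraph (Fin n)) (hG : G.graph.Connected)
    {D E : Matrix (Fin n) (Fin n) ℝ} (hDs : D.IsSymm) (hEs : E.IsSymm)
    (hDE : ∀ i, D i i = E i i)
    (h : ∀ i j, i < j → ∑ k, G.weightMatrix i k * (D i j - D k j)
      = ∑ k, G.weightMatrix i k * (E i j - E k j)) : D = E := by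
  suffices hcol : ∀ j i, D i j = E i j from Matrix.ext fun i j => hcol j i
  intro j
  -- Columns are treated from last to first: by symmetry, the entries below the diagonal of column
  -- `j` lie in later columns.
  induction j using WellFoundedGT.induction with
  | ind j ih =>
    have key := G.eq_zero_of_harmonic hG (fun i => D i j - E i j) (j := j) (fun i => ?_)
      (sub_eq_zero.2 (hDE j))
    · exact fun i => sub_eq_zero.1 (key i)
    · rcases lt_trichotomy i j with hij | rfl | hij
      · right
        rw [← sub_eq_zero.2 (h i j hij), ← Finset.sum_sub_distrib]
        exact Finset.sum_congr rfl fun k _ => by ring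
      · exact Or.inl (sub_eq_zero.2 (hDE i))
      · left
        rw [← hDs.apply i j, ← hEs.apply i j, ih i hij j, sub_self]

end StrictUpper

end WeightedGraph

theorem theorem2 (n : ℕ) (hn : 1 ≤ n) (G : WeightedGraph (Fin n))
    (D : Matrix (Fin n) (Fin n) ℝ) (hsymm : D.IsSymm) (hdiag : ∀ i, D i i = 0)
    (hD : ∀ i j, G⁻¹.weightMatrix i j ≤ D i j)
    (hupper : strictUpper (G.laplacian * D + (2 : ℝ) • (1 : Matrix (Fin n) (Fin n) ℝ)
      - Matrix.vecMulVec ((2 : ℝ) • (1 : Fin n → ℝ) - G.degreeVec) (1 : Fin n → ℝ)) = 0) :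
    G.graph.IsTree ∧ G⁻¹.IsDistanceMatrix D ∧
      G.laplacian * D + (2 : ℝ) • (1 : Matrix (Fin n) (Fin n) ℝ)
        = Matrix.vecMulVec ((2 : ℝ) • (1 : Fin n → ℝ) - G.degreeVec) (1 : Fin n → ℝ) := by
  have heq := fun i j (hij : i < j) => G.laplacian_mul_apply_of_strictUpper hupper hij
  have hT := G.isTree_of_strictUpper hn D hsymm hdiag hD heq
  obtain ⟨E, hE⟩ := G⁻¹.exists_isDistanceMatrix_of_isTree hT
  have hLE := G.laplacian_mul_of_isDistanceMatrix hT.isAcyclic hE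
  have hDE : D = E := by
    refine G.eq_of_laplacian_mul_apply_eq hT.connected hsymm (hE.isSymm hT.isAcyclic)
      (fun i => by rw [hdiag, hE.apply_self]) fun i j hij => ?_
    rw [heq i j hij]
    refine (G.laplacian_mul_apply_of_strictUpper ?_ hij).symm
    rw [hLE, sub_self]
    ext i j
    simp [strictUpper]
  subst hDE
  exact ⟨hT, hE, hLE⟩
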